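/- All index sets are countably infinite. An ideal on a set $X$ is a family $\mathcal I\subseteq\mathcal P(X)$ closed under finite unions and subsets, containing all finite subsets of $X$, with $X\notin\mathcal I$. Ideals $\mathcal I$ on $X$ and $\mathcal J$ on $Y$ are isomorphic if there is a bijection $f:Y\to X$ with $A\in\mathcal I\Leftrightarrow f^{-1}[A]\in\mathcal J$ for all $A\subseteq X$. An ideal $\mathcal I$ on $X$ is Egorov if, whenever $f_n:[0,1]\to\mathbb R$ ($n\in X$) and $f:[0,1]\to\mathbb R$ are Lebesgue measurable and for every $x\in[0,1]$ and every open $U\ni f(x)$ we have $\{n: f_n(x)\notin U\}\in\mathcal I$, then for every $\eta>0$ there is a Lebesgue measurable $M\subseteq[0,1]$ with $\lambda([0,1]\setminus M)<\eta$ such that $\{n:\ \exists x\in M\ |f_n(x)-f(x)|\ge\varepsilon\}\in\mathcal I$ for every $\varepsilon>0$. An ideal on $X$ is $\mathbf{\Pi}^0_\omega$ if it belongs to this Borel class as a subset of the product space $2^X$ (with $2=\{0,1\}$ discrete), subsets of $X$ being identified with their characteristic functions. Let $\mathrm{Fin}^1=\mathrm{Fin}$ be the ideal of finite subsets of $\omega$,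 and for $n\ge 1$ let $\mathrm{Fin}^{n+1}=\{M\subseteq\omega\times\omega^{n}:\ \{s:\ \{t:(s,t)\in M\}\notin\mathrm{Fin}^{n}\}\in\mathrm{Fin}\}$. For $M\subseteq\sum_{n\in\omega}\omega^{n+1}=\{(n,x):n\in\omega,\ x\in\omega^{n+1}\}$ put $M_{(n)}=\{x:(n,x)\in M\}$. For $A\subseteq\omega$ let $$\mathcal J_A=\Big\{M\subseteq\sum_{n\in\omega}\omega^{n+1}:\ M_{(n)}\in\mathrm{Fin}^{n+1}\text{ for all }n\in\omega,\text{ and }\{n:M_{(n)}\ne\emptyset\}\setminus A\text{ is finite}\Big\}.$$ **Theorem.** There are $2^\omega$ pairwise non-isomorphic Egorov $\mathbf{\Pi}^0_\omega$ ideals on $\omega$. Moreover, there is an almost disjoint family (any two distinct members have finite intersection) of cardinality $2^\omega$ consisting of infinite subsets of $\omega$; and for every almost disjoint family $\mathcal A$ of infinite subsets of $\omega$, each $\mathcal J_A$ with $A\in\mathcal A$ is an Egorov $\mathbf{\Pi}^0_\omega$ ideal on the countable set $\sum_{n\in\omega}\omega^{n+1}$, and $\mathcal J_A$, $\mathcal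 J_B$ are not isomorphic for distinct $A,B\in\mathcal A$. -/

import Mathlib

open MeasureTheory Cardinal Ordinal

namespace EgorovIdeals

/-- `𝓘` is an ideal on the set `X`. -/
structure IsIdealOn {X : Type*} (𝓘 : Set (Set X)) : Prop where
  union_mem : ∀ A B : Set X, A ∈ 𝓘 → B ∈ 𝓘 → A ∪ B ∈ 𝓘
  subset_mem : ∀ A B : Set X, A ⊆ B → B ∈ 𝓘 → A ∈ 𝓘
  finite_mem : ∀ A : Set X, A.Finite → A ∈ 𝓘
  univ_notMem : Set.univ ∉ 𝓘

/-- Isomorphism of ideals, witnessed by a bijection of the underlying sets. -/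
def Isomorphic {X Y : Type*} (𝓘 : Set (Set X)) (𝓙 : Set (Set Y)) : Prop :=
  ∃ f : Y ≃ X, ∀ A : Set X, A ∈ 𝓘 ↔ f ⁻¹' A ∈ 𝓙

/-- The family `x`, indexed by the underlying set of `𝓘`, is `𝓘`-convergent to `a`. -/
def IdealConverges {X E : Type*} [TopologicalSpace E] (𝓘 : Set (Set X)) (x : X → E) (a : E) :
    Prop :=
  ∀ U : Set E, IsOpen U → a ∈ U → {n | x n ∉ U} ∈ 𝓘

/-- `𝓘`-pointwise convergence of real-valued functions on `D`. -/
def IdealPointwise {X D : Type*} (𝓘 : Set (Set X)) (f : X → D → ℝ) (g : D → ℝ) : Prop :=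
  ∀ x : D, IdealConverges 𝓘 (fun n => f n x) (g x)

/-- `𝓘`-uniform convergence, on the set `M`, of real-valued functions. -/
def IdealUniformOn {X D : Type*} (𝓘 : Set (Set X)) (f : X → D → ℝ) (g : D → ℝ) (M : Set D) :
    Prop :=
  ∀ ε : ℝ, 0 < ε → {n | ∃ x ∈ M, ε ≤ |f n x - g x|} ∈ 𝓘

/-- Egorov ideals. `NullMeasurable` and `NullMeasurableSet`, taken with respect to Lebesgue
measure on `[0,1]`, are Lebesgue measurability of functions and of sets. -/
def IsEgorov {X : Type*} (𝓘 : Set (Set X)) : Prop :=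
  ∀ (f : X → Set.Icc (0 : ℝ) 1 → ℝ) (g : Set.Icc (0 : ℝ) 1 → ℝ),
    (∀ n, NullMeasurable (f n) volume) → NullMeasurable g volume → IdealPointwise 𝓘 f g →
    ∀ η : ℝ, 0 < η → ∃ M : Set (Set.Icc (0 : ℝ) 1), NullMeasurableSet M volume ∧
      volume Mᶜ < ENNReal.ofReal η ∧ IdealUniformOn 𝓘 f g M

/-- The additive Borel classes `Σ⁰_α`, for countable (indeed all) ordinals `α ≥ 1`: `Σ⁰_1` is the
class of open sets, and for `α > 1` a set is `Σ⁰_α` when it is a union of countably many sets whose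
complements are `Σ⁰_β` for some `β < α`. Nothing is `Σ⁰_0`. -/
inductive IsSigma0 {E : Type*} [TopologicalSpace E] : Ordinal.{0} → Set E → Prop
  | of_isOpen (s : Set E) (hs : IsOpen s) : IsSigma0 1 s
  | iUnion (α : Ordinal.{0}) (hα : 1 < α) (s : ℕ → Set E) (β : ℕ → Ordinal.{0})
      (hβ : ∀ n, β n < α) (hs : ∀ n, IsSigma0 (β n) (s n)ᶜ) : IsSigma0 α (⋃ n, s n)

/-- The multiplicative Borel classes `Π⁰_α`: complements of `Σ⁰_α` sets. -/
def IsPi0 {E : Type*} [TopologicalSpace E] (α : Ordinal.{0}) (s : Set E) : Prop :=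
  IsSigma0 α sᶜ

/-- A family of subsets of `X`, seen as a subset of the product space `2^X` by identifying a
subset of `X` with its characteristic function. -/
def toCantor {X : Type*} (𝓘 : Set (Set X)) : Set (X → Bool) :=
  {χ | {x | χ x = true} ∈ 𝓘}

/-- The ideal `Fin` of finite subsets of `X`. -/
def finIdeal (X : Type*) : Set (Set X) := {M | M.Finite}

/-- The Fubini product `𝓘 ⊗ 𝓙`. -/
def fubini {S T : Type*} (𝓘 : Set (Set S)) (𝓙 : Set (Set T)) : Set (Set (S × T)) :=
  {M | {s | {t | (s, t) ∈ M} ∉ 𝓙} ∈ 𝓘}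

/-- The vertical section of a subset of a disjoint sum. -/
def vsection {T : Type*} {X : T → Type*} (M : Set (Σ t, X t)) (t : T) : Set (X t) :=
  {x | (⟨t, x⟩ : Σ t, X t) ∈ M}

/-- The sum `∑ₜ 𝓘ₜ`, a family of subsets of the disjoint sum of the underlying sets. -/
def sumIdeal {T : Type*} {X : T → Type*} (𝓘 : ∀ t, Set (Set (X t))) : Set (Set (Σ t, X t)) :=
  {M | ∀ t, vsection M t ∈ 𝓘 t}

/-- `OmegaPow n` is `ω^(n+1)`: `ω¹ = ω` and `ω^(n+2) = ω × ω^(n+1)`. -/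
abbrev OmegaPow : ℕ → Type
  | 0 => ℕ
  | n + 1 => ℕ × OmegaPow n

/-- `finPow n` is the ideal `Fin^(n+1)` on `ω^(n+1)`: `Fin¹ = Fin` and
`Fin^(n+2) = Fin ⊗ Fin^(n+1)`. -/
def finPow : (n : ℕ) → Set (Set (OmegaPow n))
  | 0 => finIdeal ℕ
  | n + 1 => fubini (finIdeal ℕ) (finPow n)

/-- The family of those `M ⊆ ∑ₙ ω^(n+1)` for which `{n : M₍ₙ₎ ≠ ∅} \ A` is finite. -/
def supportIdeal (A : Set ℕ) : Set (Set (Σ n, OmegaPow n)) :=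
  {M | ({n | vsection M n ≠ ∅} \ A).Finite}

/-- `𝓙_A = (∑ₙ Fin^(n+1)) ∩ 𝓘_A`. -/
def egorovJ (A : Set ℕ) : Set (Set (Σ n, OmegaPow n)) :=
  sumIdeal finPow ∩ supportIdeal A

/-- Almost disjoint families of subsets of `ω`. -/
def AlmostDisjoint (𝒜 : Set (Set ℕ)) : Prop :=
  ∀ A ∈ 𝒜, ∀ B ∈ 𝒜, A ≠ B → (A ∩ B).Finite

end EgorovIdeals

/-!
The ideals `𝓙_A` are treated block by block, the `n`-th block being `ω^(n+1)` with the ideal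
`Fin^(n+1)`.

*Egorov property.* After passing to the sets `E i = {x | ε ≤ |f i x - g x|}`, the property says
that a family of measurable sets with all `{i | x ∈ E i}` in the ideal becomes, off a set of small
measure, one with `{i | E i ∩ M ≠ ∅}` in the ideal (`HasEgorovSets`). For `Fin` this is continuity
from above of a finite measure. For `Fin ⊗ 𝓙` put `F s = {x | {t | x ∈ E (s, t)} ∉ 𝓙}`, which is
measurable when `𝓙` is simple enough; the case of `Fin` applies to the family `F`, and that of `𝓙`
applies, for each `s`, to the sets `E (s, t) \ F s`. The exceptional sets of countably many such
applications may be joined, which also gives the case of `𝓙_A`.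

*Complexity.* If all `F s` are `Σ⁰_α`, then `{χ | χ ∈ F s for all but finitely many s}` is
`Σ⁰_(α+2)`. So each `Fin^(n+1)` is of finite additive class, and `𝓙_A` is a countable intersection
of sets of finite additive classes.

*Non-isomorphism.* No map `g` from a `Fin^(m+1)`-positive set to `ω^(n+1)`, where `m < n`, pulls
back all sets of `Fin^(n+1)` to sets of `Fin^(m+1)` (`exists_preimage_notMem_finPow`). An
isomorphism between `𝓙_A` and `𝓙_B` sends, for all but finitely many `n ∈ A`, the `n`-th block
into the union of finitely many blocks and of the blocks with index in `B`
(`exists_block_bound`). As the `n`-th block is positive, its image has positive intersection with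
one of these, the `m`-th say; the previous fact, used in both directions, gives `m = n`. Hence
`A \ B` is finite, which fails when `A` is infinite and almost disjoint from `B`.
-/

namespace EgorovIdeals

/-! ### The ideals `Fin^(n+1)` and `𝓙_A` -/

theorem IsIdealOn.empty_mem {X : Type*} {𝓘 : Set (Set X)} (h : IsIdealOn 𝓘) : ∅ ∈ 𝓘 :=
  h.finite_mem _ Set.finite_empty

theorem isIdealOn_finIdeal (X : Type*) [Infinite X] : IsIdealOn (finIdeal X) where
  union_mem _ _ hA hB := Set.Finite.union hA hB
  subset_mem _ _ hAB hB := Set.Finite.subset hB hAB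
  finite_mem _ hA := hA
  univ_notMem h := Set.infinite_univ h

theorem isIdealOn_fubini {S T : Type*} [Infinite S] {𝓙 : Set (Set T)} (h : IsIdealOn 𝓙) :
    IsIdealOn (fubini (finIdeal S) 𝓙) where
  union_mem A B hA hB := by
    refine Set.Finite.subset (Set.Finite.union hA hB) fun s hs => ?_
    by_contra hcon
    simp only [Set.mem_union, Set.mem_ofPred_eq, not_or, not_not] at hcon
    exact hs (h.union_mem _ _ hcon.1 hcon.2)
  subset_mem A B hAB hB :=
    Set.Finite.subset hB fun s hs hcon => hs (h.subset_mem _ _ (fun _ ht => hAB ht) hcon)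
  finite_mem A hA := by
    have : {s | {t | (s, t) ∈ A} ∉ 𝓙} = ∅ := by
      refine Set.eq_empty_of_forall_notMem fun s hs => hs (h.finite_mem _ ?_)
      exact hA.preimage (Prod.mk_right_injective s).injOn
    change Set.Finite _
    rw [this]
    exact Set.finite_empty
  univ_notMem hu := by
    refine Set.infinite_univ (Set.Finite.subset hu fun s _ => ?_)
    simpa using h.univ_notMem

theorem isIdealOn_finPow (n : ℕ) : IsIdealOn (finPow n) := by
  induction n with
  | zero => exact isIdealOn_finIdeal ℕ
  | succ n ih => exact isIdealOn_fubini ih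

theorem isIdealOn_egorovJ (A : Set ℕ) : IsIdealOn (egorovJ A) where
  union_mem S T hS hT := by
    refine ⟨fun n => (isIdealOn_finPow n).union_mem _ _ (hS.1 n) (hT.1 n), ?_⟩
    refine Set.Finite.subset (Set.Finite.union hS.2 hT.2) ?_
    rintro n ⟨hn, hnA⟩
    obtain ⟨u, hu | hu⟩ := Set.nonempty_iff_ne_empty.2 hn
    · exact Or.inl ⟨Set.nonempty_iff_ne_empty.1 ⟨u, hu⟩, hnA⟩
    · exact Or.inr ⟨Set.nonempty_iff_ne_empty.1 ⟨u, hu⟩, hnA⟩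
  subset_mem S T hST hT := by
    refine ⟨fun n => (isIdealOn_finPow n).subset_mem _ _ (fun _ hu => hST hu) (hT.1 n), ?_⟩
    refine Set.Finite.subset hT.2 ?_
    rintro n ⟨hn, hnA⟩
    obtain ⟨u, hu⟩ := Set.nonempty_iff_ne_empty.2 hn
    exact ⟨Set.nonempty_iff_ne_empty.1 ⟨u, hST hu⟩, hnA⟩
  finite_mem S hS := by
    refine ⟨fun n => (isIdealOn_finPow n).finite_mem _ (hS.preimage sigma_mk_injective.injOn), ?_⟩
    refine (hS.image Sigma.fst).subset ?_
    rintro n ⟨hn, -⟩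
    obtain ⟨u, hu⟩ := Set.nonempty_iff_ne_empty.2 hn
    exact ⟨_, hu, rfl⟩
  univ_notMem h := (isIdealOn_finPow 0).univ_notMem (h.1 0)

instance countable_omegaPow (n : ℕ) : Countable (OmegaPow n) := by
  induction n with
  | zero => exact inferInstanceAs (Countable ℕ)
  | succ n ih => exact inferInstanceAs (Countable (ℕ × OmegaPow n))

instance nonempty_omegaPow (n : ℕ) : Nonempty (OmegaPow n) := by
  induction n with
  | zero => exact inferInstanceAs (Nonempty ℕ)
  | succ n ih => exact inferInstanceAs (Nonempty (ℕ × OmegaPow n))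

/-! ### The Egorov property -/

section Egorov

variable {Ω : Type*} [MeasurableSpace Ω] {μ : Measure Ω}

/-- The set form of the Egorov property for an ideal `𝓘` on `X` and a measure `μ`: if every point
lies in `E i` only for `𝓘`-few `i`, then, for some `M` with complement of small measure, only
`𝓘`-few `E i` meet `M`. -/
def HasEgorovSets {X : Type*} (μ : Measure Ω) (𝓘 : Set (Set X)) : Prop :=
  ∀ E : X → Set Ω, (∀ i, NullMeasurableSet (E i) μ) → (∀ x, {i | x ∈ E i} ∈ 𝓘) →
    ∀ η : ENNReal, η ≠ 0 → ∃ M : Set Ω, NullMeasurableSet M μ ∧ μ Mᶜ < η ∧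
      {i | (E i ∩ M).Nonempty} ∈ 𝓘

/-- The family `𝓘` is definable enough for `{x | {i | x ∈ E i} ∈ 𝓘}` to be `μ`-measurable for all
families `E` of `μ`-measurable sets. -/
def HasMeasurableSections {X : Type*} (μ : Measure Ω) (𝓘 : Set (Set X)) : Prop :=
  ∀ E : X → Set Ω, (∀ i, NullMeasurableSet (E i) μ) → NullMeasurableSet {x | {i | x ∈ E i} ∈ 𝓘} μ

theorem setOf_finite_eq_iUnion_iInter {Ω : Type*} (F : ℕ → Set Ω) :
    {x | {s | x ∉ F s}.Finite} = ⋃ N, ⋂ s, F (N + s) := by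
  ext x
  simp only [Set.mem_ofPred_eq, Set.mem_iUnion, Set.mem_iInter]
  constructor
  · intro h
    obtain ⟨N, hN⟩ := h.bddAbove
    refine ⟨N + 1, fun s => by_contra fun hs => ?_⟩
    have : N + 1 + s ≤ N := hN hs
    omega
  · rintro ⟨N, hN⟩
    refine (Set.finite_lt_nat N).subset fun s hs => ?_
    by_contra hcon
    obtain ⟨k, rfl⟩ := Nat.exists_eq_add_of_le (not_lt.1 hcon)
    exact hs (hN k)

theorem hasMeasurableSections_fin : HasMeasurableSections μ (finIdeal ℕ) := by
  intro E hE
  have := setOf_finite_eq_iUnion_iInter fun s => (E s)ᶜ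
  simp only [Set.mem_compl_iff, not_not] at this
  change NullMeasurableSet {x | {s | x ∈ E s}.Finite} μ
  rw [this]
  exact .iUnion fun N => .iInter fun s => (hE _).compl

theorem HasMeasurableSections.fubini {T : Type*} {𝓙 : Set (Set T)}
    (h : HasMeasurableSections μ 𝓙) : HasMeasurableSections μ (fubini (finIdeal ℕ) 𝓙) :=
  fun E hE => hasMeasurableSections_fin (fun s => {x | {t | x ∈ E (s, t)} ∈ 𝓙}ᶜ)
    fun s => (h (fun t => E (s, t)) fun t => hE (s, t)).compl

/-- Countably many properties of sets, each of which holds for some set with complement of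
arbitrarily small measure, hold for supersets of one set with complement of small measure. -/
theorem exists_subset_of_countable {ι : Type*} [Countable ι] (P : ι → Set Ω → Prop)
    (hP : ∀ i, ∀ δ : ENNReal, δ ≠ 0 → ∃ M, NullMeasurableSet M μ ∧ μ Mᶜ < δ ∧ P i M)
    {η : ENNReal} (hη : η ≠ 0) :
    ∃ M, NullMeasurableSet M μ ∧ μ Mᶜ < η ∧ ∀ i, ∃ M', M ⊆ M' ∧ P i M' := by
  obtain ⟨δ, hδ, hsum⟩ := ENNReal.exists_pos_sum_of_countable' hη ι
  choose M hM hMδ hMP using fun i => hP i (δ i) (hδ i).ne'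
  refine ⟨⋂ i, M i, .iInter hM, ?_, fun i => ⟨M i, Set.iInter_subset _ _, hMP i⟩⟩
  rw [Set.compl_iInter]
  exact ((measure_iUnion_le _).trans (ENNReal.tsum_le_tsum fun i => (hMδ i).le)).trans_lt hsum

theorem hasEgorovSets_fin [IsFiniteMeasure μ] : HasEgorovSets μ (finIdeal ℕ) := by
  intro E hE hfin η hη
  have hU : ∀ N, NullMeasurableSet (⋃ s, E (N + s)) μ := fun N => .iUnion fun s => hE _
  have hanti : Antitone fun N => ⋃ s, E (N + s) := by
    intro a b hab
    obtain ⟨k, rfl⟩ := Nat.exists_eq_add_of_le hab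
    refine Set.iUnion_subset fun s => ?_
    rw [add_assoc]
    exact Set.subset_iUnion (fun s => E (a + s)) (k + s)
  have hempty : ⋂ N, ⋃ s, E (N + s) = ∅ := by
    have := setOf_finite_eq_iUnion_iInter fun s => (E s)ᶜ
    simp only [Set.mem_compl_iff, not_not] at this
    rw [← compl_inj_iff, Set.compl_iInter, Set.compl_empty]
    simp only [Set.compl_iUnion]
    rw [← this]
    exact Set.eq_univ_of_forall hfin
  have hlim := tendsto_measure_iInter_atTop hU hanti ⟨0, measure_ne_top μ _⟩
  rw [hempty, measure_empty] at hlim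
  obtain ⟨N, hN⟩ := (hlim.eventually (gt_mem_nhds (pos_iff_ne_zero.2 hη))).exists
  refine ⟨(⋃ s, E (N + s))ᶜ, (hU N).compl, by rwa [compl_compl], ?_⟩
  refine (Set.finite_lt_nat N).subset ?_
  rintro s ⟨x, hxs, hx⟩
  by_contra hcon
  obtain ⟨k, rfl⟩ := Nat.exists_eq_add_of_le (not_lt.1 hcon)
  exact hx (Set.mem_iUnion.2 ⟨k, hxs⟩)

theorem HasEgorovSets.fubini [IsFiniteMeasure μ] {T : Type*} {𝓙 : Set (Set T)}
    (hI : IsIdealOn 𝓙) (hm : HasMeasurableSections μ 𝓙) (h : HasEgorovSets μ 𝓙) :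
    HasEgorovSets μ (fubini (finIdeal ℕ) 𝓙) := by
  intro E hE hx η hη
  set F : ℕ → Set Ω := fun s => {x | {t | x ∈ E (s, t)} ∈ 𝓙}ᶜ with hF
  have hFm : ∀ s, NullMeasurableSet (F s) μ := fun s => (hm _ fun t => hE (s, t)).compl
  let P : Option ℕ → Set Ω → Prop := fun o M => o.elim
    ({s | (F s ∩ M).Nonempty} ∈ finIdeal ℕ) fun s => {t | ((E (s, t) \ F s) ∩ M).Nonempty} ∈ 𝓙
  have hP : ∀ o, ∀ δ : ENNReal, δ ≠ 0 → ∃ M, NullMeasurableSet M μ ∧ μ Mᶜ < δ ∧ P o M := by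
    rintro (_ | s) δ hδ
    · exact hasEgorovSets_fin F hFm hx δ hδ
    · refine h (fun t => E (s, t) \ F s) (fun t => (hE _).diff (hFm s)) (fun x => ?_) δ hδ
      by_cases hxs : x ∈ F s
      · simpa [hxs] using hI.empty_mem
      · simpa [hxs] using not_not.1 hxs
  obtain ⟨M, hM, hMη, hMP⟩ := exists_subset_of_countable P hP hη
  refine ⟨M, hM, hMη, ?_⟩
  obtain ⟨M₀, hM₀, hfin⟩ := hMP none
  refine Set.Finite.subset hfin fun s hs => ?_
  by_contra hcon
  obtain ⟨M', hM', hJ⟩ := hMP (some s)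
  refine hs (hI.subset_mem _ _ ?_ hJ)
  rintro t ⟨x, hxE, hxM⟩
  exact ⟨x, ⟨hxE, fun hxF => hcon ⟨x, hxF, hM₀ hxM⟩⟩, hM' hxM⟩

theorem hasMeasurableSections_finPow (n : ℕ) : HasMeasurableSections μ (finPow n) := by
  induction n with
  | zero => exact hasMeasurableSections_fin
  | succ n ih => exact ih.fubini

theorem hasEgorovSets_finPow [IsFiniteMeasure μ] (n : ℕ) : HasEgorovSets μ (finPow n) := by
  induction n with
  | zero => exact hasEgorovSets_fin
  | succ n ih => exact ih.fubini (isIdealOn_finPow n) (hasMeasurableSections_finPow n)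

theorem hasEgorovSets_egorovJ [IsFiniteMeasure μ] (A : Set ℕ) :
    HasEgorovSets μ (egorovJ A) := by
  intro E hE hx η hη
  let G : ℕ → Set Ω := fun n => {x | n ∉ A ∧ x ∈ ⋃ u, E ⟨n, u⟩}
  have hG : ∀ n, NullMeasurableSet (G n) μ := by
    intro n
    by_cases hn : n ∈ A
    · simp [G, hn]
    · simpa [G, hn, Set.ofPred_exists] using NullMeasurableSet.iUnion fun u => hE ⟨n, u⟩
  let P : Option ℕ → Set Ω → Prop := fun o M => o.elim
    ({n | (G n ∩ M).Nonempty} ∈ finIdeal ℕ) fun n => {u | (E ⟨n, u⟩ ∩ M).Nonempty} ∈ finPow n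
  have hP : ∀ o, ∀ δ : ENNReal, δ ≠ 0 → ∃ M, NullMeasurableSet M μ ∧ μ Mᶜ < δ ∧ P o M := by
    rintro (_ | n) δ hδ
    · refine hasEgorovSets_fin G hG (fun x => ?_) δ hδ
      refine Set.Finite.subset (hx x).2 ?_
      rintro n ⟨hn, hxn⟩
      obtain ⟨u, hu⟩ := Set.mem_iUnion.1 hxn
      exact ⟨Set.nonempty_iff_ne_empty.1 ⟨u, hu⟩, hn⟩
    · exact hasEgorovSets_finPow n (fun u => E ⟨n, u⟩) (fun u => hE _) (fun x => (hx x).1 n) δ hδ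
  obtain ⟨M, hM, hMη, hMP⟩ := exists_subset_of_countable P hP hη
  refine ⟨M, hM, hMη, fun n => ?_, ?_⟩
  · obtain ⟨M', hM', hJ⟩ := hMP (some n)
    exact (isIdealOn_finPow n).subset_mem _ _
      (fun u hu => hu.mono (Set.inter_subset_inter_right _ hM')) hJ
  · obtain ⟨M', hM', hfin⟩ := hMP none
    refine Set.Finite.subset hfin ?_
    rintro n ⟨hn, hnA⟩
    obtain ⟨u, x, hxE, hxM⟩ := Set.nonempty_iff_ne_empty.2 hn
    exact ⟨x, ⟨hnA, Set.mem_iUnion.2 ⟨u, hxE⟩⟩, hM' hxM⟩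

end Egorov

theorem IsEgorov.of_hasEgorovSets {X : Type*} {𝓘 : Set (Set X)} (hI : IsIdealOn 𝓘)
    (h : HasEgorovSets (volume : Measure (Set.Icc (0 : ℝ) 1)) 𝓘) : IsEgorov 𝓘 := by
  intro f g hf hg hfg η hη
  obtain ⟨M, hM, hMη, hMP⟩ := exists_subset_of_countable
    (fun (k : ℕ) (M : Set (Set.Icc (0 : ℝ) 1)) =>
      {n | ({x | 1 / ((k : ℝ) + 1) ≤ |f n x - g x|} ∩ M).Nonempty} ∈ 𝓘)
    (fun k δ hδ => by
      refine h (fun n => {x | 1 / ((k : ℝ) + 1) ≤ |f n x - g x|}) (fun n => ?_) (fun x => ?_) δ hδ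
      · have hd : AEMeasurable (fun x => |f n x - g x|) volume := by
          exact ((hf n).aemeasurable.sub hg.aemeasurable).norm
        exact hd.nullMeasurable measurableSet_Ici
      · have := hfg x (Metric.ball (g x) (1 / ((k : ℝ) + 1))) Metric.isOpen_ball
          (Metric.mem_ball_self (by positivity))
        simpa only [Metric.mem_ball, Real.dist_eq, not_lt, Set.mem_ofPred_eq] using this)
    (ENNReal.ofReal_pos.2 hη).ne'
  refine ⟨M, hM, hMη, fun ε hε => ?_⟩
  obtain ⟨k, hk⟩ := exists_nat_one_div_lt hε
  obtain ⟨M', hM', hJ⟩ := hMP k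
  refine hI.subset_mem _ _ ?_ hJ
  rintro n ⟨x, hxM, hx⟩
  exact ⟨x, hk.le.trans hx, hM' hxM⟩

/-! ### Borel complexity -/

theorem IsSigma0.preimage {E F : Type*} [TopologicalSpace E] [TopologicalSpace F] {φ : E → F}
    (hφ : Continuous φ) {α : Ordinal.{0}} {s : Set F} (hs : IsSigma0 α s) :
    IsSigma0 α (φ ⁻¹' s) := by
  induction hs with
  | of_isOpen s hs => exact .of_isOpen _ (hs.preimage hφ)
  | iUnion α hα s β hβ _ ih =>
    rw [Set.preimage_iUnion]
    exact .iUnion α hα _ β hβ ih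

theorem IsSigma0.one_le {E : Type*} [TopologicalSpace E] {α : Ordinal.{0}} {s : Set E}
    (hs : IsSigma0 α s) : 1 ≤ α := by
  cases hs with
  | of_isOpen => exact le_rfl
  | iUnion _ hα => exact hα.le

theorem IsSigma0.of_isClosed {E : Type*} [TopologicalSpace E] {s : Set E} (hs : IsClosed s) :
    IsSigma0 2 s := by
  have := IsSigma0.iUnion 2 one_lt_two (fun _ : ℕ => s) (fun _ => 1) (fun _ => one_lt_two)
    fun _ => .of_isOpen _ hs.isOpen_compl
  rwa [Set.iUnion_const] at this

theorem IsSigma0.setOf_finite {E : Type*} [TopologicalSpace E] {k : ℕ} {F : ℕ → Set E}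
    (hF : ∀ s, IsSigma0 (k : Ordinal.{0}) (F s)) :
    IsSigma0 ((k + 2 : ℕ) : Ordinal.{0}) {χ | {s | χ ∉ F s}.Finite} := by
  have hk : 1 ≤ k := by exact_mod_cast (hF 0).one_le
  rw [setOf_finite_eq_iUnion_iInter]
  refine .iUnion _ (by exact_mod_cast (by omega : 1 < k + 2)) _ (fun _ => ((k + 1 : ℕ) : Ordinal))
    (fun _ => by exact_mod_cast Nat.lt_succ_self (k + 1)) fun N => ?_
  rw [Set.compl_iInter]
  refine .iUnion _ (by exact_mod_cast (by omega : 1 < k + 1)) _ (fun _ => (k : Ordinal))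
    (fun _ => by exact_mod_cast Nat.lt_succ_self k) fun s => ?_
  rw [compl_compl]
  exact hF _

theorem isSigma0_finPow (n : ℕ) :
    ∃ k : ℕ, IsSigma0 (k : Ordinal.{0}) (toCantor (finPow n)) := by
  induction n with
  | zero =>
    refine ⟨1 + 2, ?_⟩
    have := IsSigma0.setOf_finite (k := 1) (F := fun s : ℕ => {χ : ℕ → Bool | χ s = false})
      fun s => by
        rw [Nat.cast_one]
        exact .of_isOpen _ ((isOpen_discrete ({false} : Set Bool)).preimage (continuous_apply (A := fun _ : ℕ => Bool) s))
    simp only [Set.mem_ofPred_eq, Bool.not_eq_false] at this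
    exact this
  | succ n ih =>
    obtain ⟨k, hk⟩ := ih
    exact ⟨k + 2, IsSigma0.setOf_finite
      (F := fun s => (fun (χ : ℕ × OmegaPow n → Bool) t => χ (s, t)) ⁻¹' toCantor (finPow n))
      fun s => hk.preimage (by fun_prop)⟩

theorem isSigma0_supportIdeal (A : Set ℕ) :
    ∃ k : ℕ, IsSigma0 (k : Ordinal.{0}) (toCantor (supportIdeal A)) := by
  refine ⟨2 + 2, ?_⟩
  have := IsSigma0.setOf_finite (k := 2)
    (F := fun n => {χ : (Σ n, OmegaPow n) → Bool | n ∉ A → ∀ u, χ ⟨n, u⟩ = false}) fun n => by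
      rw [Nat.cast_two]
      refine .of_isClosed ?_
      by_cases hn : n ∈ A
      · simp [hn]
      · simp only [hn, not_false_eq_true, forall_const, Set.ofPred_forall]
        exact isClosed_iInter fun u => isClosed_eq (continuous_apply _) continuous_const
  convert this using 1
  ext χ
  change Set.Finite _ ↔ Set.Finite _
  refine iff_of_eq (congrArg _ (Set.ext fun n => ?_))
  simp only [Set.mem_sdiff, Set.mem_ofPred_eq, ← Set.nonempty_iff_ne_empty, Set.Nonempty, vsection]
  simp [and_comm]

theorem isPi0_egorovJ (A : Set ℕ) : IsPi0 ω (toCantor (egorovJ A)) := by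
  choose k hk using isSigma0_finPow
  obtain ⟨l, hl⟩ := isSigma0_supportIdeal A
  have hs := IsSigma0.iUnion ω one_lt_omega0
    (fun j => Nat.casesOn j (toCantor (supportIdeal A))ᶜ fun n =>
      ((fun (χ : (Σ n, OmegaPow n) → Bool) u => χ ⟨n, u⟩) ⁻¹' toCantor (finPow n))ᶜ)
    (fun j => Nat.casesOn j (l : Ordinal) fun n => (k n : Ordinal))
    (by rintro (_ | n) <;> exact natCast_lt_omega0 _)
    (by
      rintro (_ | n)
      · exact (compl_compl (toCantor (supportIdeal A))).symm ▸ hl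
      · exact (compl_compl (_ ⁻¹' toCantor (finPow n))).symm ▸ (hk n).preimage (by fun_prop))
  unfold IsPi0
  convert hs using 1
  rw [← compl_inj_iff, compl_compl, Set.compl_iUnion]
  ext χ
  simp only [Set.mem_iInter]
  constructor
  · rintro ⟨h1, h2⟩ (_ | n)
    · exact not_not.2 h2
    · exact not_not.2 (h1 n)
  · exact fun h => ⟨fun n => not_not.1 (h (n + 1)), not_not.1 (h 0)⟩

/-! ### Non-isomorphism -/

/-- `Fin^(n+1)` is not Katětov below the restriction of `Fin^(m+1)` to a positive set if `m < n`. -/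
theorem exists_preimage_notMem_finPow {m n : ℕ} (hmn : m < n) {Q : Set (OmegaPow m)}
    (hQ : Q ∉ finPow m) (g : OmegaPow m → OmegaPow n) :
    ∃ S ∈ finPow n, Q ∩ g ⁻¹' S ∉ finPow m := by
  induction m generalizing n with
  | zero =>
    obtain ⟨n, rfl⟩ := Nat.exists_eq_succ_of_ne_zero hmn.ne'
    by_contra! hcon
    -- If columns have finite preimages, then all columns of the image `g '' Q` are finite.
    refine hQ ?_
    have hcol : ∀ k : ℕ, (Q ∩ g ⁻¹' {p : ℕ × OmegaPow n | p.1 = k}).Finite := by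
      refine fun k => hcon {p : ℕ × OmegaPow n | p.1 = k} ?_
      refine (Set.finite_singleton k).subset fun s hs => ?_
      by_contra hsk
      refine hs ?_
      have : {t : OmegaPow n | ((s, t) : ℕ × OmegaPow n) ∈ {p | p.1 = k}} = ∅ :=
        Set.eq_empty_of_forall_notMem fun t ht => hsk ht
      rw [this]
      exact (isIdealOn_finPow n).empty_mem
    have himg : g '' Q ∈ finPow (n + 1) := by
      have : {s : ℕ | {t : OmegaPow n | ((s, t) : ℕ × OmegaPow n) ∈ g '' Q} ∉ finPow n} = ∅ := by
        refine Set.eq_empty_of_forall_notMem fun s hs => hs ?_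
        refine (isIdealOn_finPow n).finite_mem _ ?_
        refine (((hcol s).image g).preimage (Prod.mk_right_injective s).injOn).subset ?_
        rintro t ⟨q, hq, hqt⟩
        exact ⟨q, ⟨hq, congrArg Prod.fst hqt⟩, hqt⟩
      change Set.Finite _
      rw [this]
      exact Set.finite_empty
    have := hcon _ himg
    rwa [Set.inter_eq_left.2 (Set.subset_preimage_image g Q)] at this
  | succ m ih =>
    obtain ⟨n, rfl⟩ := Nat.exists_eq_succ_of_ne_zero (by omega : n ≠ 0)
    have hI := isIdealOn_finPow m
    by_contra! hcon
    let g₁ : ℕ → OmegaPow m → ℕ := fun s t => (g (s, t)).1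
    let g₂ : ℕ → OmegaPow m → OmegaPow n := fun s t => (g (s, t)).2
    let Qs : ℕ → Set (OmegaPow m) := fun s => {t | ((s, t) : ℕ × OmegaPow m) ∈ Q}
    have hS : {s | Qs s ∉ finPow m}.Infinite := hQ
    have hcol : ∀ k : ℕ, {s | Qs s ∩ {t | g₁ s t = k} ∉ finPow m}.Finite := by
      refine fun k => hcon {p : ℕ × OmegaPow n | p.1 = k} ?_
      refine (Set.finite_singleton k).subset fun s hs => ?_
      by_contra hsk
      refine hs ?_
      have : {t : OmegaPow n | ((s, t) : ℕ × OmegaPow n) ∈ {p | p.1 = k}} = ∅ :=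
        Set.eq_empty_of_forall_notMem fun t ht => hsk ht
      rw [this]
      exact (isIdealOn_finPow n).empty_mem
    have hrow : ∀ s, ∃ S ∈ finPow n, Qs s ∉ finPow m → Qs s ∩ g₂ s ⁻¹' S ∉ finPow m := by
      intro s
      by_cases hs : Qs s ∉ finPow m
      · obtain ⟨S, hSn, hS⟩ := ih (by omega) hs (g₂ s)
        exact ⟨S, hSn, fun _ => hS⟩
      · exact ⟨∅, (isIdealOn_finPow n).empty_mem, fun h => absurd h hs⟩
    choose S hSn hSpos using hrow
    -- `good k` holds the rows `s` whose set `S s` is put into column `k` of the set `W` below. It is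
    -- finite, so the columns of `W` are in the ideal. A row `s` loses only the columns `k` with
    -- `s ∉ good k`; they are finitely many, and each has a small preimage in that row.
    let good : ℕ → Set ℕ := fun k => {s | s ≤ k ∨ ∃ j ≤ k, Qs s ∩ {t | g₁ s t = j} ∉ finPow m}
    have hgood : ∀ k, (good k).Finite := by
      intro k
      refine ((Set.finite_le_nat k).union
        ((Set.finite_le_nat k).biUnion fun j _ => hcol j)).subset ?_
      rintro s (hs | ⟨j, hj, hs⟩)
      · exact Or.inl hs
      · exact Or.inr (Set.mem_biUnion (show j ∈ {i | i ≤ k} from hj) hs)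
    have hbiUnion : ∀ {p : ℕ} (T : Set ℕ) (_ : T.Finite) (R : ℕ → Set (OmegaPow p))
        (_ : ∀ s ∈ T, R s ∈ finPow p), ⋃ s ∈ T, R s ∈ finPow p := by
      intro p T hT R
      induction T, hT using Set.Finite.induction_on with
      | empty => simpa using (isIdealOn_finPow p).empty_mem
      | insert _ _ ihT =>
        intro hR
        rw [Set.biUnion_insert]
        exact (isIdealOn_finPow p).union_mem _ _ (hR _ (Set.mem_insert _ _))
          (ihT fun s hs => hR s (Set.mem_insert_of_mem _ hs))
    let W : Set (ℕ × OmegaPow n) := {p | p.2 ∈ ⋃ s ∈ good p.1, S s}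
    have hW : W ∈ finPow (n + 1) := by
      have : {k : ℕ | {u : OmegaPow n | ((k, u) : ℕ × OmegaPow n) ∈ W} ∉ finPow n} = ∅ :=
        Set.eq_empty_of_forall_notMem fun k hk => hk (hbiUnion _ (hgood k) S fun s _ => hSn s)
      change Set.Finite _
      rw [this]
      exact Set.finite_empty
    refine hS (Set.Finite.subset (hcon W hW) fun s hs hmem => ?_)
    have hlost : ⋃ j ∈ {j | s ∉ good j}, Qs s ∩ {t | g₁ s t = j} ∈ finPow m := by
      refine hbiUnion _ ((Set.finite_lt_nat s).subset fun j hj => ?_) _ fun j hj => ?_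
      · exact not_le.1 fun hle => hj (Or.inl hle)
      · exact by_contra fun hneg => hj (Or.inr ⟨j, le_rfl, hneg⟩)
    refine hSpos s hs (hI.subset_mem _ _ ?_ (hI.union_mem _ _ hmem hlost))
    rintro t ⟨htQ, htS⟩
    by_cases hg : s ∈ good (g₁ s t)
    · exact Or.inl ⟨htQ, Set.mem_biUnion hg htS⟩
    · exact Or.inr (Set.mem_biUnion (show g₁ s t ∈ {j | s ∉ good j} from hg) ⟨htQ, rfl⟩)

theorem vsection_image_mk_of_ne {T : Type*} {X : T → Type*} {s t : T} (h : t ≠ s)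
    (S : Set (X s)) : vsection (Sigma.mk s '' S) t = ∅ := by
  refine Set.eq_empty_of_forall_notMem ?_
  rintro u ⟨v, -, hv⟩
  exact h (congrArg Sigma.fst hv).symm

theorem image_mk_mem_egorovJ (A : Set ℕ) {n : ℕ} {S : Set (OmegaPow n)} (hS : S ∈ finPow n) :
    Sigma.mk n '' S ∈ egorovJ A := by
  refine ⟨fun k => ?_, (Set.finite_singleton n).subset ?_⟩
  · by_cases hk : k = n
    · subst hk
      have : vsection (Sigma.mk k '' S) k = S := Set.preimage_image_eq S sigma_mk_injective
      rwa [this]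
    · rw [vsection_image_mk_of_ne hk]
      exact (isIdealOn_finPow k).empty_mem
  · rintro k ⟨hk, -⟩
    by_contra hkn
    exact hk (vsection_image_mk_of_ne hkn S)

/-- A map pulling back `𝓙_A` into `𝓙_B` sends a positive part of the `m`-th block into the `n`-th
block only if `n ≤ m`. -/
theorem le_of_block_positive {A B : Set ℕ} {f : (Σ n, OmegaPow n) → Σ n, OmegaPow n}
    (hf : ∀ S ∈ egorovJ A, f ⁻¹' S ∈ egorovJ B) {m n : ℕ}
    (hQ : {u : OmegaPow m | (f ⟨m, u⟩).1 = n} ∉ finPow m) : n ≤ m := by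
  by_contra! hmn
  obtain ⟨S, hS, hpos⟩ := exists_preimage_notMem_finPow hmn hQ
    fun u => Function.invFun (Sigma.mk n) (f ⟨m, u⟩)
  refine hpos ((isIdealOn_finPow m).subset_mem _ _ ?_ ((hf _ (image_mk_mem_egorovJ A hS)).1 m))
  rintro u ⟨hu, huS⟩
  obtain ⟨v, hv⟩ : ∃ v : OmegaPow n, (⟨n, v⟩ : Σ n, OmegaPow n) = f ⟨m, u⟩ := by
    subst hu
    exact ⟨_, rfl⟩
  refine ⟨_, huS, ?_⟩
  exact Function.invFun_eq ⟨v, hv⟩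

/-- An isomorphism pulls back almost all blocks with index in `A` into the blocks with index in
`B` and finitely many others: otherwise one point from each of infinitely many blocks outside `B`
would give a set of `𝓙_A` that is pulled back outside `𝓙_B`. -/
theorem exists_block_bound {A B : Set ℕ} (f : (Σ n, OmegaPow n) ≃ Σ n, OmegaPow n)
    (hf : ∀ S ∈ egorovJ A, f ⁻¹' S ∈ egorovJ B) :
    ∃ N, ∀ y, (f y).1 ∈ A → N ≤ (f y).1 → y.1 ∈ B ∨ y.1 < N := by
  by_contra! hcon
  choose y hyA hyN hyB hy using hcon
  have hmem : Set.range (f ∘ y) ∈ egorovJ A := by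
    refine ⟨fun n => (isIdealOn_finPow n).finite_mem _ ?_, ?_⟩
    · refine (((Set.finite_le_nat n).image (f ∘ y)).preimage sigma_mk_injective.injOn).subset ?_
      rintro u ⟨N, hN⟩
      refine ⟨N, ?_, hN⟩
      have : (f (y N)).1 = n := congrArg Sigma.fst hN
      exact this ▸ hyN N
    · refine Set.Finite.subset Set.finite_empty ?_
      rintro n ⟨hn, hnA⟩
      obtain ⟨u, N, hN⟩ := Set.nonempty_iff_ne_empty.2 hn
      have : (f (y N)).1 = n := congrArg Sigma.fst hN
      exact hnA (this ▸ hyA N)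
  obtain ⟨K, hK⟩ := (hf _ hmem).2.bddAbove
  have : (y (K + 1)).1 ≤ K :=
    hK ⟨Set.nonempty_iff_ne_empty.1 ⟨(y (K + 1)).2, K + 1, rfl⟩, hyB _⟩
  have := hy (K + 1)
  omega

theorem not_isomorphic_egorovJ {A B : Set ℕ} (hA : A.Infinite) (hAB : (A ∩ B).Finite) :
    ¬ Isomorphic (egorovJ A) (egorovJ B) := by
  rintro ⟨f, hf⟩
  obtain ⟨N, hN⟩ := exists_block_bound f fun S => (hf S).1
  obtain ⟨n, hnA, hn⟩ := (hA.sdiff (hAB.union (Set.finite_lt_nat N))).nonempty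
  simp only [Set.mem_union, Set.mem_inter_iff, hnA, true_and, Set.mem_ofPred_eq, not_or,
    not_lt] at hn
  have hblock : Sigma.fst ⁻¹' {n} ∉ egorovJ A := by
    intro h
    refine (isIdealOn_finPow n).univ_notMem ((isIdealOn_finPow n).subset_mem _ _ ?_ (h.1 n))
    exact fun u _ => rfl
  rw [hf] at hblock
  obtain ⟨m, hm⟩ : ∃ m, {u : OmegaPow m | (f ⟨m, u⟩).1 = n} ∉ finPow m := by
    by_contra! hcon
    refine hblock ⟨hcon, (Set.finite_lt_nat N).subset ?_⟩
    rintro m ⟨hm, hmB⟩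
    obtain ⟨u, hu⟩ := Set.nonempty_iff_ne_empty.2 hm
    have hu : (f ⟨m, u⟩).1 = n := hu
    exact (hN ⟨m, u⟩ (hu ▸ hnA) (hu ▸ hn.2)).resolve_left hmB
  have hnm : n ≤ m := le_of_block_positive (fun S => (hf S).1) hm
  have hmn : m ≤ n := by
    refine le_of_block_positive (f := f.symm) (A := B) (B := A)
      (fun S hS => (hf _).2 (by rwa [← Set.preimage_comp, f.symm_comp_self])) fun hcon => hm ?_
    refine (isIdealOn_finPow m).subset_mem _ _ ?_
      (((hf _).1 (image_mk_mem_egorovJ A hcon)).1 m)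
    intro u hu
    subst hu
    refine ⟨(f ⟨m, u⟩).2, ?_, rfl⟩
    change (f.symm (f ⟨m, u⟩)).1 = m
    rw [f.symm_apply_apply]
  obtain rfl := le_antisymm hnm hmn
  obtain ⟨u, hu⟩ : {u : OmegaPow n | (f ⟨n, u⟩).1 = n}.Nonempty := by
    by_contra hcon
    rw [Set.not_nonempty_iff_eq_empty] at hcon
    exact hm (hcon ▸ (isIdealOn_finPow n).empty_mem)
  have hu : (f ⟨n, u⟩).1 = n := hu
  rcases hN ⟨n, u⟩ (hu.symm ▸ hnA) (hu.symm ▸ hn.2) with h | h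
  · exact hn.1 h
  · exact absurd hn.2 (not_le.2 h)

/-! ### Transport along bijections -/

/-- The image of a family of subsets of `X` under a bijection `X ≃ Y`. -/
def transport {X Y : Type*} (e : X ≃ Y) (𝓘 : Set (Set X)) : Set (Set Y) := {S | e ⁻¹' S ∈ 𝓘}

theorem IsIdealOn.transport {X Y : Type*} (e : X ≃ Y) {𝓘 : Set (Set X)} (h : IsIdealOn 𝓘) :
    IsIdealOn (transport e 𝓘) where
  union_mem _ _ hA hB := h.union_mem _ _ hA hB
  subset_mem _ _ hAB hB := h.subset_mem _ _ (Set.preimage_mono hAB) hB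
  finite_mem _ hA := h.finite_mem _ (hA.preimage e.injective.injOn)
  univ_notMem := h.univ_notMem

theorem IsEgorov.transport {X Y : Type*} (e : X ≃ Y) {𝓘 : Set (Set X)} (h : IsEgorov 𝓘) :
    IsEgorov (transport e 𝓘) :=
  fun f g hf hg hfg => h (fun n => f (e n)) g (fun n => hf (e n)) hg hfg

theorem IsPi0.transport {X Y : Type*} (e : X ≃ Y) {𝓘 : Set (Set X)} {α : Ordinal.{0}}
    (h : IsPi0 α (toCantor 𝓘)) : IsPi0 α (toCantor (transport e 𝓘)) :=
  IsSigma0.preimage (φ := fun χ : Y → Bool => χ ∘ e) (by fun_prop) h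

theorem Isomorphic.of_transport {X Y : Type*} (e : X ≃ Y) {𝓘 𝓙 : Set (Set X)}
    (h : Isomorphic (transport e 𝓘) (transport e 𝓙)) : Isomorphic 𝓘 𝓙 := by
  obtain ⟨f, hf⟩ := h
  refine ⟨(e.trans f).trans e.symm, fun S => ?_⟩
  have := hf (e.symm ⁻¹' S)
  simp only [transport, Set.mem_ofPred_eq, ← Set.preimage_comp, e.symm_comp_self,
    Set.preimage_id] at this
  exact this

theorem Isomorphic.refl {X : Type*} (𝓘 : Set (Set X)) : Isomorphic 𝓘 𝓘 :=
  ⟨Equiv.refl X, fun _ => Iff.rfl⟩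

/-! ### Almost disjoint families -/

/-- The codes of the finite initial segments of `x`. -/
def branch (x : ℕ → Bool) : Set ℕ :=
  Set.range fun n => Encodable.encode ((List.range n).map x)

theorem branch_infinite (x : ℕ → Bool) : (branch x).Infinite := by
  refine Set.infinite_range_of_injective fun a b hab => ?_
  simpa using congrArg List.length (Encodable.encode_injective hab)

theorem finite_branch_inter {x y : ℕ → Bool} (h : x ≠ y) : (branch x ∩ branch y).Finite := by
  obtain ⟨k, hk⟩ := Function.ne_iff.1 h
  refine ((Set.finite_le_nat k).image
    fun n => Encodable.encode ((List.range n).map x)).subset ?_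
  rintro _ ⟨⟨n, rfl⟩, ⟨n', hn'⟩⟩
  have heq := Encodable.encode_injective hn'
  obtain rfl : n' = n := by simpa using congrArg List.length heq
  refine ⟨n', ?_, rfl⟩
  by_contra hcon
  rw [List.map_inj_left] at heq
  exact hk (heq k (List.mem_range.2 (not_le.1 hcon))).symm

theorem exists_almostDisjoint :
    ∃ 𝒜 : Set (Set ℕ), AlmostDisjoint 𝒜 ∧ (∀ A ∈ 𝒜, A.Infinite) ∧ #𝒜 = 𝔠 := by
  have hinj : Function.Injective branch := by
    intro x y hxy
    by_contra hne
    have := finite_branch_inter hne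
    rw [hxy, Set.inter_self] at this
    exact branch_infinite y this
  refine ⟨Set.range branch, ?_, ?_, ?_⟩
  · rintro _ ⟨x, rfl⟩ _ ⟨y, rfl⟩ hxy
    exact finite_branch_inter fun h => hxy (congrArg branch h)
  · rintro _ ⟨x, rfl⟩
    exact branch_infinite x
  · rw [Cardinal.mk_range_eq _ hinj]
    simp

end EgorovIdeals

open EgorovIdeals in
theorem mainTheorem3 :
    -- continuum many pairwise non-isomorphic Egorov `Π⁰_ω` ideals on `ω`
    (∃ 𝓕 : Set (Set (Set ℕ)), #𝓕 = 𝔠 ∧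
      (∀ 𝓘 ∈ 𝓕, IsIdealOn 𝓘 ∧ IsEgorov 𝓘 ∧ IsPi0 ω (toCantor 𝓘)) ∧
      (∀ 𝓘 ∈ 𝓕, ∀ 𝓙 ∈ 𝓕, 𝓘 ≠ 𝓙 → ¬ Isomorphic 𝓘 𝓙)) ∧
    -- there is an almost disjoint family of infinite sets of size continuum
    (∃ 𝒜 : Set (Set ℕ), AlmostDisjoint 𝒜 ∧ (∀ A ∈ 𝒜, A.Infinite) ∧ #𝒜 = 𝔠) ∧
    -- every such family gives pairwise non-isomorphic Egorov `Π⁰_ω` ideals `𝓙_A`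
    (∀ 𝒜 : Set (Set ℕ), AlmostDisjoint 𝒜 → (∀ A ∈ 𝒜, A.Infinite) →
      (∀ A ∈ 𝒜, IsIdealOn (egorovJ A) ∧ IsEgorov (egorovJ A) ∧
        IsPi0 ω (toCantor (egorovJ A))) ∧
      (∀ A ∈ 𝒜, ∀ B ∈ 𝒜, A ≠ B → ¬ Isomorphic (egorovJ A) (egorovJ B))) := by
  have hE : ∀ A, IsEgorov (egorovJ A) := fun A =>
    .of_hasEgorovSets (isIdealOn_egorovJ A) (hasEgorovSets_egorovJ A)
  refine ⟨?_, exists_almostDisjoint, fun 𝒜 hAD hinf =>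
    ⟨fun A _ => ⟨isIdealOn_egorovJ A, hE A, isPi0_egorovJ A⟩,
      fun A hA B hB hAB => not_isomorphic_egorovJ (hinf A hA) (hAD A hA B hB hAB)⟩⟩
  obtain ⟨𝒜, hAD, hinf, hcard⟩ := exists_almostDisjoint
  obtain ⟨e⟩ : Nonempty ((Σ n, OmegaPow n) ≃ ℕ) := nonempty_equiv_of_countable
  have hne : ∀ A ∈ 𝒜, ∀ B ∈ 𝒜, A ≠ B →
      ¬ Isomorphic (transport e (egorovJ A)) (transport e (egorovJ B)) :=
    fun A hA B hB hAB h =>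
      not_isomorphic_egorovJ (hinf A hA) (hAD A hA B hB hAB) (h.of_transport e)
  refine ⟨(fun A => transport e (egorovJ A)) '' 𝒜, ?_, ?_, ?_⟩
  · rw [Cardinal.mk_image_eq_of_injOn, hcard]
    intro A hA B hB hAB
    by_contra hcon
    refine hne A hA B hB hcon ?_
    rw [show transport e (egorovJ A) = transport e (egorovJ B) from hAB]
    exact .refl _
  · rintro _ ⟨A, -, rfl⟩
    exact ⟨(isIdealOn_egorovJ A).transport e, (hE A).transport e, (isPi0_egorovJ A).transport e⟩
  · rintro _ ⟨A, hA, rfl⟩ _ ⟨B, hB, rfl⟩ hAB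
    exact hne A hA B hB fun h => hAB (by rw [h])
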